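/- Let $1\le s\le n$ be integers and let $C\in\mathbb{R}^{n\times n}$ be symmetric positive definite, $t=\lambda_{\min}(C)>0$. The maximum-entropy sampling problem (MESP) is $$z^*=\max\{\log\det C_{S,S}: S\subseteq[n],\ |S|=s\},$$ where $C_{S,S}$ is the principal submatrix indexed by $S$; a solution $S$ is identified with its characteristic vector in $\{0,1\}^n$. For a vector $y\in\mathbb{R}^n$ let $y_i^{\downarrow}$ be its $i$-th largest entry, and for a symmetric matrix $X$ let $\lambda_1(X)\ge\dots\ge\lambda_n(X)$ be its eigenvalues. Let $A\in\mathbb{R}^{n\times n}$ satisfy $C-tI=A^{\top}A$, with columns $a_1,\dots,a_n$, and put $M_t(x)=\sum_{i=1}^n x_i a_ia_i^{\top}$ for $x\in[0,1]^n$. Let $\widehat\Phi_s(\cdot\,;t)$ be the concave envelope (pointwise infimum of the concave overestimators), on the cone of positive semidefinite $n\times n$ matrices, of $\Phi_s(X;t)=\sum_{i=1}^s\log(\lambda_i(X)+t)$. Let $\tilde x\in[0,1]^n$ with $\sum_i\tilde x_i=s$. Let $M_t(\tilde x)=Q\,\mathrm{Diag}(\lambda)\,Q^{\top}$ be an eigendecomposition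 with $Q$ orthogonal and $\lambda_1\ge\dots\ge\lambda_n\ge0$; set $y_i=\lambda_i+t$ for $i\le s$ and $y_i=\lambda_i$ for $i>s$; let $k$ be the integer with $0\le k\le s-1$ and $y_k>\frac1{s-k}\sum_{i=k+1}^n y_i\ge y_{k+1}$ (where $y_0=\infty$); and set $\gamma_i=1/y_i$ for $i\le k$ and $\gamma_i=(s-k)/\sum_{j=k+1}^n y_j$ for $i\ge k+1$. Let $\tilde g\in\mathbb{R}^n$ be the subgradient of $x\mapsto\widehat\Phi_s(M_t(x);t)$ at $\tilde x$ given by $\tilde g_i=a_i^{\top}Q\,\mathrm{Diag}(\gamma)\,Q^{\top}a_i$. Put $$UB=\widehat\Phi_s(M_t(\tilde x);t)-\tilde g^{\top}\tilde x+\sum_{i=1}^s\tilde g_i^{\downarrow},$$ and let $LB$ be any real number with $LB\le z^*$. Then every optimal solution $x^*$ of MESP satisfies, for every $i\in[n]$: (i) if $s<n$ and $\tilde g_i-\tilde g_{s+1}^{\downarrow}>UB-LB$, then $x_i^*=1$; (ii) if $\tilde g_s^{\downarrow}-\tilde g_i>UB-LB$, then $x_i^*=0$. -/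

import Mathlib

open scoped Matrix

noncomputable section

namespace MESP

variable {n : ℕ}

/-- The nonincreasing rearrangement `y↓` of a vector `y`; the `j`-th largest entry of `y`
(for `1 ≤ j ≤ n`) is the entry of `desc y` at position `j - 1`. -/
def desc (y : Fin n → ℝ) : Fin n → ℝ :=
  fun i => y (Tuple.sort y i.rev)

theorem desc_antitone (y : Fin n → ℝ) : Antitone (desc y) :=
  fun _ _ h => Tuple.monotone_sort y (Fin.rev_le_rev.mpr h)

/-- The eigenvalue vector `λ(X)` of a real symmetric matrix, in nonincreasing order
(with multiplicity). It is only used at symmetric `X`. -/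
def eig (X : Matrix (Fin n) (Fin n) ℝ) : Fin n → ℝ :=
  open Classical in
  if h : X.IsHermitian then desc h.eigenvalues else 0

/-- The smallest eigenvalue of a real symmetric matrix (`n ≥ 1`). -/
def lambdaMin {X : Matrix (Fin n) (Fin n) ℝ} (hX : X.IsHermitian) : ℝ :=
  ⨅ i, hX.eigenvalues i

/-- `log det C_{S,S}`. -/
def logDet (C : Matrix (Fin n) (Fin n) ℝ) (S : Finset (Fin n)) : ℝ :=
  Real.log (C.submatrix (fun i : S => (i : Fin n)) (fun i : S => (i : Fin n))).det

/-- The optimal value `z* = max {log det C_{S,S} : |S| = s}`. -/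
def optValue (C : Matrix (Fin n) (Fin n) ℝ) (s : ℕ) : ℝ :=
  ⨆ S : {S : Finset (Fin n) // S.card = s}, logDet C S.1

/-- `x` is (the characteristic vector of) an optimal solution of
`max {log det C_{S,S} : |S| = s}`. -/
def IsOptimal (C : Matrix (Fin n) (Fin n) ℝ) (s : ℕ) (x : Fin n → ℝ) : Prop :=
  ∃ S : Finset (Fin n), S.card = s ∧
    (∀ T : Finset (Fin n), T.card = s → logDet C T ≤ logDet C S) ∧
    ∀ i, x i = if i ∈ S then 1 else 0

/-- `A` is an `n × n` factor of `C - t I`, that is, `C - t I = Aᵀ A`. -/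
def IsFactor (C : Matrix (Fin n) (Fin n) ℝ) (t : ℝ) (A : Matrix (Fin n) (Fin n) ℝ) : Prop :=
  C - t • (1 : Matrix (Fin n) (Fin n) ℝ) = Aᵀ * A

/-- `M(x) = ∑ i, x i • a_i a_iᵀ`, where `a_i` is the `i`-th column of `A`. -/
def M (A : Matrix (Fin n) (Fin n) ℝ) (x : Fin n → ℝ) : Matrix (Fin n) (Fin n) ℝ :=
  ∑ i, x i • Matrix.vecMulVec (A.col i) (A.col i)

/-- `Φ_s(X; t) = ∑_{i ≤ s} log (λ_i(X) + t)`. -/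
def Phi (s : ℕ) (t : ℝ) (X : Matrix (Fin n) (Fin n) ℝ) : ℝ :=
  ∑ i : Fin n with i.val < s, Real.log (eig X i + t)

/-- The concave envelope of `f` on `D`: the pointwise infimum of all concave functions on `D`
that lie above `f` on `D`. -/
def concaveEnvelope {E : Type*} [AddCommGroup E] [Module ℝ E] (D : Set E) (f : E → ℝ) (X : E) :
    ℝ :=
  sInf {r : ℝ | ∃ h : E → ℝ, ConcaveOn ℝ D h ∧ (∀ Y ∈ D, f Y ≤ h Y) ∧ h X = r}

/-- The concave envelope of `X ↦ Φ_s(X; t)` on the cone of positive semidefinite matrices. -/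
def PhiHat (s : ℕ) (t : ℝ) (X : Matrix (Fin n) (Fin n) ℝ) : ℝ :=
  concaveEnvelope {Y : Matrix (Fin n) (Fin n) ℝ | Y.PosSemidef} (Phi s t) X

/-- Feasibility for the continuous relaxation: `x ∈ [0,1]^n` and `∑ x_i = s`. -/
def IsFeasible (s : ℕ) (x : Fin n → ℝ) : Prop :=
  (∀ i, 0 ≤ x i ∧ x i ≤ 1) ∧ ∑ i, x i = s

/-- `λ + t 𝕀_s`: the first `s` entries are increased by `t`. -/
def perturb (s : ℕ) (t : ℝ) (l : Fin n → ℝ) : Fin n → ℝ :=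
  fun i => if i.val < s then l i + t else l i

/-- For a nonincreasing `y`, the average `(1/(s-k)) ∑_{i ≥ k+1} y_i` (used for `k < s`). -/
def tailAvg (s k : ℕ) (y : Fin n → ℝ) : ℝ :=
  (∑ i : Fin n with k ≤ i.val, y i) / ((s : ℝ) - (k : ℝ))

/-- For a nonincreasing `y`: `0 ≤ k ≤ s - 1` and
`y_k > (1/(s-k)) ∑_{i ≥ k+1} y_i ≥ y_{k+1}`, where `y_0 = ∞`
(the entry `y_j` sits at position `j - 1`). -/
def IsSplitIndex (s : ℕ) (y : Fin n → ℝ) (k : ℕ) : Prop :=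
  k < s ∧ (∀ i : Fin n, i.val + 1 = k → tailAvg s k y < y i) ∧
    (∀ i : Fin n, i.val = k → y i ≤ tailAvg s k y)

/-- The vector with entries `1 / y_i` for `i ≤ k` and `(s-k) / ∑_{j ≥ k+1} y_j` for `i ≥ k+1`. -/
def psiGrad (s k : ℕ) (y : Fin n → ℝ) : Fin n → ℝ :=
  fun i => if i.val < k then 1 / y i
    else ((s : ℝ) - (k : ℝ)) / ∑ j : Fin n with k ≤ j.val, y j

/-- `g` is a subgradient of `x ↦ Φ̂_s(M(x); t)` at `x` given by the spectral formula
`g_i = a_iᵀ Q Diag(γ) Qᵀ a_i`, where `M(x) = Q Diag(λ) Qᵀ` is an eigendecomposition with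
nonincreasing `λ`, and `γ` is the subgradient above at the vector `λ + t 𝕀_s`. -/
def IsSpectralSubgradient (A : Matrix (Fin n) (Fin n) ℝ) (s : ℕ) (t : ℝ)
    (x g : Fin n → ℝ) : Prop :=
  ∃ (Q : Matrix (Fin n) (Fin n) ℝ) (l : Fin n → ℝ) (k : ℕ),
    Q ∈ Matrix.orthogonalGroup (Fin n) ℝ ∧ Antitone l ∧
    M A x = Q * Matrix.diagonal l * Qᵀ ∧
    IsSplitIndex s (perturb s t l) k ∧
    ∀ i, g i = A.col i ⬝ᵥ
      ((Q * Matrix.diagonal (psiGrad s k (perturb s t l)) * Qᵀ) *ᵥ A.col i)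

/-- `UB = Φ̂_s(M(x); t) - gᵀ x + ∑_{i ≤ s} g_i↓`. -/
def upperBound (A : Matrix (Fin n) (Fin n) ℝ) (s : ℕ) (t : ℝ) (x g : Fin n → ℝ) : ℝ :=
  PhiHat s t (M A x) - g ⬝ᵥ x + ∑ i : Fin n with i.val < s, desc g i

end MESP

end

open scoped Matrix

namespace MESP

variable {n : ℕ}

/-! Everything rests on `logDet_le_linearization`: log det C_{S,S} ≤ Φ̂(M(x)) - g·x + ∑_{i∈S} g_i
for |S| = s. If an optimal S omits i, comparing g on S ∪ {i} with its s + 1 largest entries bounds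
z* by UB + g↓_{s+1} - g_i; if S contains i, comparing S \ {i} with the s - 1 largest gives UB - g↓_s
+ g_i. Either strict inequality would push z* below LB.

For the linearization, put Γ = Q Diag(γ) Qᵀ. The tangent bound log u ≤ u - 1 and the lower von
Neumann trace inequality give an affine majorant of Φ_s with slope Γ (`Phi_le_affine`); log det
C_{S,S} is Φ_s at the matrix of S (`logDet_eq_Phi`). The constants match at x because ∑ γ_i y_i = s.
What remains is -∑_{i≤s} log γ_i ≤ Φ̂(M(x)) (`sum_neg_log_psiGrad_le_PhiHat`): by Birkhoff, λ is a
convex combination of permutations of a vector μ supported on s entries, and every concave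
overestimator is at least this value at each permuted μ. No closed formula for Φ̂ is needed, only
this lower bound. -/

/-! ### Index ranges and sorted vectors. -/

theorem card_val_lt {m : ℕ} (hm : m ≤ n) :
    (Finset.univ.filter fun i : Fin n => i.val < m).card = m := by
  simp [Fin.card_filter_val_lt, hm]

theorem card_le_val_lt {k s : ℕ} (hks : k ≤ s) (hsn : s ≤ n) :
    (Finset.univ.filter fun i : Fin n => k ≤ i.val ∧ i.val < s).card = s - k := by
  have h1 := Finset.card_filter_add_card_filter_not
    (s := Finset.univ.filter fun i : Fin n => i.val < s) (fun i => i.val < k)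
  rw [Finset.filter_filter, Finset.filter_filter, card_val_lt hsn] at h1
  have h2 : (Finset.univ.filter fun i : Fin n => i.val < s ∧ i.val < k) =
      Finset.univ.filter fun i : Fin n => i.val < k := by
    ext i; simp; omega
  have h3 : (Finset.univ.filter fun i : Fin n => i.val < s ∧ ¬ i.val < k) =
      Finset.univ.filter fun i : Fin n => k ≤ i.val ∧ i.val < s := by
    ext i; simp; omega
  rw [h2, h3, card_val_lt (hks.trans hsn)] at h1
  omega

theorem sum_val_lt_add_sum_le_val (m : ℕ) (f : Fin n → ℝ) :
    (∑ i : Fin n with i.val < m, f i) + ∑ i : Fin n with m ≤ i.val, f i = ∑ i, f i := by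
  rw [← Finset.sum_filter_add_sum_filter_not Finset.univ (fun i : Fin n => i.val < m) f]
  simp only [not_lt]

theorem sum_le_val_lt_add_sum_le_val {k s : ℕ} (hks : k ≤ s) (f : Fin n → ℝ) :
    (∑ i : Fin n with k ≤ i.val ∧ i.val < s, f i) + ∑ i : Fin n with s ≤ i.val, f i =
      ∑ i : Fin n with k ≤ i.val, f i := by
  rw [← Finset.sum_filter_add_sum_filter_not (Finset.univ.filter fun i : Fin n => k ≤ i.val)
    (fun i : Fin n => i.val < s) f, Finset.filter_filter, Finset.filter_filter]
  congr 2
  ext i; simp; omega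

theorem sum_val_lt_eq_add {k s : ℕ} (hks : k ≤ s) (f : Fin n → ℝ) :
    ∑ i : Fin n with i.val < s, f i =
      (∑ i : Fin n with i.val < k, f i) + ∑ i : Fin n with k ≤ i.val ∧ i.val < s, f i := by
  have h1 := sum_val_lt_add_sum_le_val s f
  have h2 := sum_val_lt_add_sum_le_val k f
  have h3 := sum_le_val_lt_add_sum_le_val hks f
  linarith

/-- After subtracting the threshold value at position `T.card - 1`, terms beyond it are nonpositive
and terms up to it nonnegative, so trading the former for the latter can only help. -/
theorem sum_le_sum_val_lt {f : Fin n → ℝ} (hf : Antitone f) (T : Finset (Fin n)) :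
    ∑ i ∈ T, f i ≤ ∑ i : Fin n with i.val < T.card, f i := by
  have hTn : T.card ≤ n := by simpa using T.card_le_univ
  rcases Nat.eq_zero_or_pos T.card with h0 | hpos
  · simp [Finset.card_eq_zero.mp h0]
  set m := T.card with hm
  let c := f ⟨m - 1, by omega⟩
  have h1 : ∑ i ∈ T, (f i - c) ≤ ∑ i ∈ T with i.val < m, (f i - c) := by
    rw [← Finset.sum_filter_add_sum_filter_not T (fun i : Fin n => i.val < m)]
    have : ∑ i ∈ T with ¬ i.val < m, (f i - c) ≤ 0 :=
      Finset.sum_nonpos fun i hi => sub_nonpos.mpr <| hf <| by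
        simp only [Finset.mem_filter] at hi
        exact Fin.le_def.mpr (by simp; omega)
    linarith
  have h2 : ∑ i ∈ T with i.val < m, (f i - c) ≤ ∑ i : Fin n with i.val < m, (f i - c) := by
    refine Finset.sum_le_sum_of_subset_of_nonneg
      (Finset.filter_subset_filter _ (Finset.subset_univ _)) fun i hi _ => sub_nonneg.mpr <| hf ?_
    simp only [Finset.mem_filter] at hi
    exact Fin.le_def.mpr (by simp; omega)
  have h3 := h1.trans h2
  simp only [Finset.sum_sub_distrib, Finset.sum_const, card_val_lt hTn, ← hm] at h3
  linarith

theorem exists_perm_desc_eq (y : Fin n → ℝ) : ∃ σ : Equiv.Perm (Fin n), desc y = y ∘ σ :=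
  ⟨Fin.revPerm.trans (Tuple.sort y), rfl⟩

theorem sum_le_sum_desc (y : Fin n → ℝ) (T : Finset (Fin n)) :
    ∑ i ∈ T, y i ≤ ∑ i : Fin n with i.val < T.card, desc y i := by
  obtain ⟨σ, hσ⟩ := exists_perm_desc_eq y
  have h := sum_le_sum_val_lt (desc_antitone y) (T.map σ.symm.toEmbedding)
  simpa [hσ] using h

theorem desc_eq_of_map_eq {x y : Fin n → ℝ}
    (h : Finset.univ.val.map x = Finset.univ.val.map y) : desc x = desc y := by
  have key : ∀ z : Fin n → ℝ, Finset.univ.val.map (desc z) = Finset.univ.val.map z := fun z => by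
    obtain ⟨σ, hσ⟩ := exists_perm_desc_eq z
    rw [hσ, ← Multiset.map_map, Multiset.map_univ_val_equiv]
  rw [← key x, ← key y, Fin.univ_val_map, Fin.univ_val_map, Multiset.coe_eq_coe] at h
  exact List.ofFn_injective (h.eq_of_pairwise' (r := (· ≥ ·))
    (desc_antitone x).sortedGE_ofFn.pairwise (desc_antitone y).sortedGE_ofFn.pairwise)

/-! ### Sorted eigenvalues and diagonalization. -/

theorem eig_eq_desc {X : Matrix (Fin n) (Fin n) ℝ} (hX : X.IsHermitian) :
    eig X = desc hX.eigenvalues :=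
  dif_pos hX

theorem eig_antitone (X : Matrix (Fin n) (Fin n) ℝ) : Antitone (eig X) := by
  unfold eig
  split_ifs with h
  · exact desc_antitone _
  · exact antitone_const

theorem eig_nonneg {X : Matrix (Fin n) (Fin n) ℝ} (hX : X.PosSemidef) (i : Fin n) :
    0 ≤ eig X i := by
  rw [eig_eq_desc hX.isHermitian]
  exact hX.eigenvalues_nonneg _

theorem transpose_mul_self_of_mem {Q : Matrix (Fin n) (Fin n) ℝ}
    (hQ : Q ∈ Matrix.orthogonalGroup (Fin n) ℝ) : Qᵀ * Q = 1 := by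
  simpa [Matrix.star_eq_conjTranspose] using (Matrix.mem_orthogonalGroup_iff' _ _).mp hQ

theorem mul_transpose_self_of_mem {Q : Matrix (Fin n) (Fin n) ℝ}
    (hQ : Q ∈ Matrix.orthogonalGroup (Fin n) ℝ) : Q * Qᵀ = 1 := by
  simpa [Matrix.star_eq_conjTranspose] using (Matrix.mem_orthogonalGroup_iff _ _).mp hQ

theorem isHermitian_conj_diagonal (Q : Matrix (Fin n) (Fin n) ℝ) (d : Fin n → ℝ) :
    (Q * Matrix.diagonal d * Qᵀ).IsHermitian := by
  simp [Matrix.IsHermitian, Matrix.conjTranspose_eq_transpose_of_trivial, Matrix.transpose_mul,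
    Matrix.mul_assoc]

theorem posSemidef_conj_diagonal (Q : Matrix (Fin n) (Fin n) ℝ) {d : Fin n → ℝ}
    (hd : ∀ i, 0 ≤ d i) : (Q * Matrix.diagonal d * Qᵀ).PosSemidef := by
  simpa [Matrix.conjTranspose_eq_transpose_of_trivial] using
    (Matrix.posSemidef_diagonal_iff.mpr hd).mul_mul_conjTranspose_same Q

/-- The characteristic polynomial is invariant under conjugation, so both sides sort the same
multiset of roots. -/
theorem eig_conj_diagonal {Q : Matrix (Fin n) (Fin n) ℝ}
    (hQ : Q ∈ Matrix.orthogonalGroup (Fin n) ℝ) (d : Fin n → ℝ) :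
    eig (Q * Matrix.diagonal d * Qᵀ) = desc d := by
  have hX := isHermitian_conj_diagonal Q d
  rw [eig_eq_desc hX]
  apply desc_eq_of_map_eq
  have h := hX.roots_charpoly_eq_eigenvalues
  rw [Matrix.charpoly_mul_comm, ← Matrix.mul_assoc, transpose_mul_self_of_mem hQ, Matrix.one_mul,
    Matrix.charpoly_diagonal, Polynomial.roots_prod] at h
  · simpa using h.symm
  · simp [Finset.prod_ne_zero_iff, Polynomial.X_sub_C_ne_zero]

/-- Spectral theorem with the eigenvalues in nonincreasing order. -/
theorem exists_eq_conj_diagonal_eig {X : Matrix (Fin n) (Fin n) ℝ} (hX : X.IsHermitian) :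
    ∃ U ∈ Matrix.orthogonalGroup (Fin n) ℝ, X = U * Matrix.diagonal (eig X) * Uᵀ := by
  obtain ⟨σ, hσ⟩ := exists_perm_desc_eq hX.eigenvalues
  let V : Matrix (Fin n) (Fin n) ℝ := hX.eigenvectorUnitary
  have hV : V * Vᵀ = 1 := mul_transpose_self_of_mem hX.eigenvectorUnitary.2
  refine ⟨V.submatrix id σ, ?_, ?_⟩
  · rw [Matrix.mem_orthogonalGroup_iff]
    simp [Matrix.transpose_submatrix, Matrix.submatrix_mul_equiv, hV]
  · have h := hX.spectral_theorem
    rw [Unitary.conjStarAlgAut_apply] at h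
    have h' : X = V * Matrix.diagonal hX.eigenvalues * Vᵀ := by
      simpa [Matrix.star_eq_conjTranspose, Matrix.conjTranspose_eq_transpose_of_trivial] using! h
    rw [eig_eq_desc hX, hσ, ← Matrix.submatrix_diagonal_equiv, Matrix.transpose_submatrix,
      Matrix.submatrix_mul_equiv, Matrix.submatrix_mul_equiv, Matrix.submatrix_id_id, ← h']

/-! ### Birkhoff's theorem and the trace inequality. -/

theorem mulVec_mem_convexHull {D : Matrix (Fin n) (Fin n) ℝ}
    (hD : D ∈ doublyStochastic ℝ (Fin n)) (v : Fin n → ℝ) :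
    D *ᵥ v ∈ convexHull ℝ (Set.range fun σ : Equiv.Perm (Fin n) => v ∘ σ) := by
  obtain ⟨w, hw0, hw1, rfl⟩ := exists_eq_sum_perm_of_mem_doublyStochastic hD
  refine mem_convexHull_of_exists_fintype w (fun σ => v ∘ σ) hw0 hw1 (fun σ => ⟨σ, rfl⟩) ?_
  rw [Matrix.sum_mulVec]
  simp [Matrix.smul_mulVec, Matrix.permMatrix_mulVec]

/-- The condition is a half-space in the vector `D *ᵥ b`, so it suffices to check permutations of
`b`; there it is the rearrangement inequality. -/
theorem sum_mul_le_sum_mul_mulVec {D : Matrix (Fin n) (Fin n) ℝ}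
    (hD : D ∈ doublyStochastic ℝ (Fin n)) {a b : Fin n → ℝ} (hab : Antivary a b) :
    ∑ i, a i * b i ≤ ∑ i, a i * (D *ᵥ b) i := by
  have hconv : Convex ℝ {v : Fin n → ℝ | ∑ i, a i * b i ≤ ∑ i, a i * v i} := by
    refine convex_halfSpace_ge ⟨fun v w => ?_, fun r v => ?_⟩ _
    · simp [mul_add, Finset.sum_add_distrib]
    · simp [Finset.mul_sum, mul_left_comm]
  refine convexHull_min ?_ hconv (mulVec_mem_convexHull hD b)
  rintro _ ⟨σ, rfl⟩
  exact hab.sum_mul_le_sum_mul_comp_perm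

/-- The squared entries of an orthogonal matrix form a doubly stochastic matrix. -/
theorem sq_mem_doublyStochastic {W : Matrix (Fin n) (Fin n) ℝ}
    (hW : W ∈ Matrix.orthogonalGroup (Fin n) ℝ) :
    (Matrix.of fun i j => W i j ^ 2) ∈ doublyStochastic ℝ (Fin n) := by
  refine mem_doublyStochastic_iff_sum.mpr ⟨fun i j => sq_nonneg _, fun i => ?_, fun j => ?_⟩
  · have := congrFun (congrFun (mul_transpose_self_of_mem hW) i) i
    simpa [Matrix.mul_apply, sq] using this
  · have := congrFun (congrFun (transpose_mul_self_of_mem hW) j) j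
    simpa [Matrix.mul_apply, sq] using this

/-- The lower von Neumann trace inequality. -/
theorem sum_mul_eig_le_trace {Q : Matrix (Fin n) (Fin n) ℝ}
    (hQ : Q ∈ Matrix.orthogonalGroup (Fin n) ℝ) {a : Fin n → ℝ} (ha : Monotone a)
    {X : Matrix (Fin n) (Fin n) ℝ} (hX : X.IsHermitian) :
    ∑ i, a i * eig X i ≤ ((Q * Matrix.diagonal a * Qᵀ) * X).trace := by
  obtain ⟨U, hU, hXU⟩ := exists_eq_conj_diagonal_eig hX
  set e := eig X with he
  have hQ' : Qᵀ ∈ Matrix.orthogonalGroup (Fin n) ℝ := by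
    rw [Matrix.mem_orthogonalGroup_iff]
    simpa [Matrix.star_eq_conjTranspose] using transpose_mul_self_of_mem hQ
  have hW := mul_mem hQ' hU
  have hav : Antivary a e := ha.antivary (eig_antitone X)
  -- With W = QᵀU the trace equals ∑ a_i W_ij² e_j.
  refine (sum_mul_le_sum_mul_mulVec (sq_mem_doublyStochastic hW) hav).trans_eq ?_
  have h1 : ((Q * Matrix.diagonal a * Qᵀ) * X).trace =
      (Matrix.diagonal a * ((Qᵀ * U) * Matrix.diagonal e * (Qᵀ * U)ᵀ)).trace := by
    rw [hXU, Matrix.mul_assoc Q, Matrix.mul_assoc Q, Matrix.trace_mul_comm Q]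
    simp only [Matrix.transpose_mul, Matrix.transpose_transpose, Matrix.mul_assoc]
  rw [h1, Matrix.trace]
  refine Finset.sum_congr rfl fun i _ => ?_
  rw [Matrix.diag_apply, Matrix.diagonal_mul, Matrix.mul_apply]
  congr 1
  rw [Matrix.mulVec, dotProduct]
  refine Finset.sum_congr rfl fun j _ => ?_
  rw [Matrix.mul_diagonal, Matrix.transpose_apply, Matrix.of_apply]
  ring

/-! ### The objective as a spectral function. -/

/-- With B the columns of A in S, C_{S,S} = tI + BᵀB. Sylvester's identity det(1 + t⁻¹BᵀB) = det(1 +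
t⁻¹BBᵀ) passes to BBᵀ = M(x), whose rank is at most |S|, so only the first |S| eigenvalues
contribute. -/
theorem logDet_eq_Phi {C : Matrix (Fin n) (Fin n) ℝ} {t : ℝ} (ht : 0 < t)
    {A : Matrix (Fin n) (Fin n) ℝ} (hA : IsFactor C t A) (S : Finset (Fin n)) :
    logDet C S = Phi S.card t (M A fun i => if i ∈ S then 1 else 0) := by
  have hSn : S.card ≤ n := by simpa using S.card_le_univ
  set B : Matrix (Fin n) S ℝ := A.submatrix id (fun i : S => (i : Fin n)) with hB
  have hM : M A (fun i => if i ∈ S then 1 else 0) = B * Bᵀ := by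
    ext a b
    simp only [M, Matrix.sum_apply, Matrix.smul_apply, Matrix.vecMulVec_apply, Matrix.mul_apply,
      Matrix.transpose_apply, hB, Matrix.submatrix_apply, id, smul_eq_mul, ite_mul, one_mul,
      zero_mul, Matrix.col_apply]
    rw [← Finset.sum_filter, Finset.filter_mem_eq_inter, Finset.univ_inter]
    exact (Finset.sum_coe_sort S fun i => A a i * A b i).symm
  have hC : C.submatrix (fun i : S => (i : Fin n)) (fun i : S => (i : Fin n)) =
      t • (1 + (t⁻¹ • Bᵀ) * B) := by
    have h : C = t • (1 : Matrix (Fin n) (Fin n) ℝ) + Aᵀ * A := by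
      rw [← show C - t • 1 = Aᵀ * A from hA]; abel
    rw [smul_add, Matrix.smul_mul, smul_smul, mul_inv_cancel₀ ht.ne', one_smul, h]
    ext a b
    simp [hB, Matrix.mul_apply, Matrix.one_apply]
  rw [hM]
  set X := B * Bᵀ with hXdef
  have hX : X.PosSemidef := by
    simpa [Matrix.conjTranspose_eq_transpose_of_trivial] using
      Matrix.posSemidef_self_mul_conjTranspose B
  obtain ⟨U, hU, hXU⟩ := exists_eq_conj_diagonal_eig hX.isHermitian
  set e := eig X with he
  have he0 : ∀ i, 0 ≤ e i := eig_nonneg hX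
  have hUU := transpose_mul_self_of_mem hU
  have hdet : (C.submatrix (fun i : S => (i : Fin n)) (fun i : S => (i : Fin n))).det =
      t ^ S.card * ∏ i, (1 + t⁻¹ * e i) := by
    rw [hC, Matrix.det_smul, Fintype.card_coe, Matrix.det_one_add_mul_comm, Matrix.mul_smul]
    congr 1
    have h1 : (1 : Matrix (Fin n) (Fin n) ℝ) + t⁻¹ • (B * Bᵀ) =
        U * (Matrix.diagonal fun i => 1 + t⁻¹ * e i) * Uᵀ := by
      have h2 : (Matrix.diagonal fun i => 1 + t⁻¹ * e i) =
          (1 : Matrix (Fin n) (Fin n) ℝ) + t⁻¹ • Matrix.diagonal e := by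
        rw [← Matrix.diagonal_one, ← Matrix.diagonal_smul, Matrix.diagonal_add]
        rfl
      rw [← hXdef, h2, Matrix.mul_add, Matrix.add_mul, Matrix.mul_one,
        mul_transpose_self_of_mem hU, Matrix.mul_smul, Matrix.smul_mul, ← hXU]
    rw [h1, Matrix.mul_assoc,
      Matrix.det_mul_comm, Matrix.mul_assoc, hUU, Matrix.mul_one, Matrix.det_diagonal]
  have hrank : (Matrix.diagonal e).rank ≤ S.card := by
    have h1 : Matrix.diagonal e = Uᵀ * B * (Bᵀ * U) := by
      calc Matrix.diagonal e = (Uᵀ * U) * Matrix.diagonal e * (Uᵀ * U) := by simp [hUU]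
        _ = Uᵀ * (U * Matrix.diagonal e * Uᵀ) * U := by simp only [Matrix.mul_assoc]
        _ = Uᵀ * B * (Bᵀ * U) := by rw [← hXU, hXdef]; simp only [Matrix.mul_assoc]
    rw [h1]
    exact (Matrix.rank_mul_le_left _ _).trans ((Matrix.rank_le_card_width _).trans (by simp))
  have hzero : ∀ i : Fin n, S.card ≤ i.val → e i = 0 := by
    intro i hi
    by_contra hne
    have hpos : 0 < e i := lt_of_le_of_ne (he0 i) (Ne.symm hne)
    rw [Matrix.rank_diagonal, Fintype.card_subtype] at hrank
    have hsub : (Finset.univ.filter fun j : Fin n => j.val < i.val + 1) ⊆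
        Finset.univ.filter fun j : Fin n => e j ≠ 0 := by
      intro j hj
      simp only [Finset.mem_filter, Finset.mem_univ, true_and] at hj ⊢
      exact (hpos.trans_le (eig_antitone X (Fin.le_def.mpr (by omega)))).ne'
    have := Finset.card_le_card hsub
    rw [card_val_lt (by omega)] at this
    omega
  have hprod : ∏ i, (1 + t⁻¹ * e i) = ∏ i : Fin n with i.val < S.card, (1 + t⁻¹ * e i) := by
    symm
    refine Finset.prod_subset (Finset.subset_univ _) fun i _ hi => ?_
    simp only [Finset.mem_filter, Finset.mem_univ, true_and, not_lt] at hi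
    simp [hzero i hi]
  rw [logDet, hdet, hprod]
  nth_rewrite 1 [← card_val_lt hSn]
  rw [← Finset.prod_const, ← Finset.prod_mul_distrib, Phi, ← he, Real.log_prod]
  · refine Finset.sum_congr rfl fun i _ => ?_
    congr 1
    field_simp
    ring
  · intro i _
    have := he0 i
    positivity

theorem M_posSemidef (A : Matrix (Fin n) (Fin n) ℝ) {x : Fin n → ℝ} (hx : ∀ i, 0 ≤ x i) :
    (M A x).PosSemidef := by
  refine Matrix.posSemidef_sum _ fun i _ => Matrix.PosSemidef.smul ?_ (hx i)
  simpa using Matrix.posSemidef_vecMulVec_self_star (A.col i)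

theorem trace_mul_M (G A : Matrix (Fin n) (Fin n) ℝ) (x : Fin n → ℝ) :
    (G * M A x).trace = ∑ i, x i * (A.col i ⬝ᵥ (G *ᵥ A.col i)) := by
  simp only [M, Finset.mul_sum, Matrix.trace_sum, Matrix.mul_smul, Matrix.trace_smul, smul_eq_mul,
    Matrix.mul_vecMulVec, Matrix.trace_vecMulVec, dotProduct_comm]

theorem nonneg_of_conj_diagonal_posSemidef {Q : Matrix (Fin n) (Fin n) ℝ}
    (hQ : Q ∈ Matrix.orthogonalGroup (Fin n) ℝ) {d : Fin n → ℝ}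
    (h : (Q * Matrix.diagonal d * Qᵀ).PosSemidef) (i : Fin n) : 0 ≤ d i := by
  have h1 := h.conjTranspose_mul_mul_same Q
  have h2 : Qᵀ * (Q * Matrix.diagonal d * Qᵀ) * Q = Matrix.diagonal d := by
    calc _ = (Qᵀ * Q) * Matrix.diagonal d * (Qᵀ * Q) := by simp only [Matrix.mul_assoc]
      _ = _ := by simp [transpose_mul_self_of_mem hQ]
  rw [Matrix.conjTranspose_eq_transpose_of_trivial, h2] at h1
  exact Matrix.posSemidef_diagonal_iff.mp h1 i

/-- A nonincreasing nonnegative vector is the image, under a doubly stochastic matrix, of the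
vector which keeps its first `k` entries and concentrates the rest evenly on the entries
`k, …, s - 1`, provided that this average is at least the entry `k`. -/
theorem exists_doublyStochastic_mulVec_eq {k s : ℕ} (hks : k < s) (hsn : s ≤ n) {l : Fin n → ℝ}
    (hl0 : ∀ i, 0 ≤ l i) {b : ℝ} (hb : ∀ i : Fin n, k ≤ i.val → l i ≤ b)
    (hsum : ∑ i : Fin n with k ≤ i.val, l i = ((s : ℝ) - k) * b) :
    ∃ D ∈ doublyStochastic ℝ (Fin n),
      D *ᵥ (fun i : Fin n => if i.val < k then l i else if i.val < s then b else 0) = l := by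
  set μ : Fin n → ℝ := fun i => if i.val < k then l i else if i.val < s then b else 0 with hμ
  -- The matrix `D` below divides by b and by n - s; if either vanishes then l = μ, and the identity
  -- serves instead.
  by_cases hlμ : l = μ
  · exact ⟨1, one_mem _, by rw [Matrix.one_mulVec, ← hlμ]⟩
  have hks' : (0 : ℝ) < (s : ℝ) - k := sub_pos.mpr (by exact_mod_cast hks)
  have hb0 : 0 < b := by
    have hb0' : 0 ≤ b := (hl0 ⟨k, by omega⟩).trans (hb ⟨k, by omega⟩ le_rfl)
    refine lt_of_le_of_ne hb0' fun hb' => hlμ (funext fun i => ?_)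
    by_cases hi : i.val < k
    · simp [hμ, hi]
    · have := hb i (by omega)
      have := hl0 i
      simp only [hμ, hi, if_false, ← hb', ite_self]
      linarith
  have hsn' : s < n := by
    refine lt_of_le_of_ne hsn fun h => hlμ (funext fun i => ?_)
    have hz : ∑ j : Fin n with k ≤ j.val, (b - l j) = 0 := by
      have hc := card_le_val_lt (n := n) hks.le hsn
      have hf : (Finset.univ.filter fun i : Fin n => k ≤ i.val ∧ i.val < s) =
          Finset.univ.filter fun i : Fin n => k ≤ i.val := by
        ext j; simp; omega
      rw [hf] at hc
      rw [Finset.sum_sub_distrib, hsum, Finset.sum_const, hc, nsmul_eq_mul, Nat.cast_sub hks.le]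
      ring
    by_cases hi : i.val < k
    · simp [hμ, hi]
    · have := (Finset.sum_eq_zero_iff_of_nonneg (fun j hj => sub_nonneg.mpr
        (hb j (Finset.mem_filter.mp hj).2))).mp hz i (by simp; omega)
      have hi' : i.val < s := h ▸ i.isLt
      simp only [hμ, hi, hi', if_false, if_true]
      linarith
  have hns : (0 : ℝ) < (n : ℝ) - s := sub_pos.mpr (by exact_mod_cast hsn')
  have hcard1 : ((Finset.univ.filter fun i : Fin n => k ≤ i.val ∧ i.val < s).card : ℝ) =
      (s : ℝ) - k := by
    rw [card_le_val_lt hks.le hsn, Nat.cast_sub hks.le]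
  have hcard2 : ((Finset.univ.filter fun i : Fin n => s ≤ i.val).card : ℝ) = (n : ℝ) - s := by
    rw [← Nat.cast_sub hsn, ← card_le_val_lt (n := n) hsn le_rfl]
    congr 2
    ext j; simp
  have hcard3 : ((Finset.univ.filter fun i : Fin n => k ≤ i.val).card : ℝ) = (n : ℝ) - k := by
    rw [← Nat.cast_sub (by omega : k ≤ n), ← card_le_val_lt (n := n) (by omega : k ≤ n) le_rfl]
    congr 2
    ext j; simp
  -- Row i ≥ k spreads mass l_i / b evenly over the columns where μ = b and the rest over those
  -- where μ = 0. Column sums are 1 because the l_i / b with i ≥ k add up to s - k.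
  let D : Matrix (Fin n) (Fin n) ℝ := Matrix.of fun i j =>
    if i.val < k then (if i = j then 1 else 0)
    else if j.val < k then 0
    else if j.val < s then l i / b / (s - k) else (1 - l i / b) / (n - s)
  have hrow : ∀ i : Fin n, k ≤ i.val → ∀ f : Fin n → ℝ, ∑ j, D i j * f j =
      l i / b / (s - k) * (∑ j : Fin n with k ≤ j.val ∧ j.val < s, f j) +
        (1 - l i / b) / (n - s) * ∑ j : Fin n with s ≤ j.val, f j := by
    intro i hi f
    rw [← sum_val_lt_add_sum_le_val s, sum_val_lt_eq_add hks.le, Finset.mul_sum, Finset.mul_sum]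
    have h0 : ∑ j : Fin n with j.val < k, D i j * f j = 0 := by
      refine Finset.sum_eq_zero fun j hj => ?_
      simp only [Finset.mem_filter] at hj
      simp [D, hi.not_gt, hj.2]
    rw [h0, zero_add]
    congr 1
    · refine Finset.sum_congr rfl fun j hj => ?_
      simp only [Finset.mem_filter] at hj
      simp [D, hi.not_gt, hj.2.1.not_gt, hj.2.2]
    · refine Finset.sum_congr rfl fun j hj => ?_
      simp only [Finset.mem_filter] at hj
      simp [D, hi.not_gt, hj.2.not_gt, (hks.le.trans hj.2).not_gt]
  refine ⟨D, mem_doublyStochastic_iff_sum.mpr ⟨fun i j => ?_, fun i => ?_, fun j => ?_⟩, ?_⟩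
  · simp only [D, Matrix.of_apply]
    split_ifs with h1 h2 h3 h4
    · exact zero_le_one
    · exact le_rfl
    · exact le_rfl
    · exact div_nonneg (div_nonneg (hl0 i) hb0.le) hks'.le
    · exact div_nonneg (sub_nonneg.mpr ((div_le_one hb0).mpr (hb i (by omega)))) hns.le
  · by_cases hi : i.val < k
    · simp [D, hi]
    · have := hrow i (by omega) 1
      simp only [Pi.one_apply, mul_one, Finset.sum_const, nsmul_eq_mul, hcard1, hcard2] at this
      rw [this, div_mul_cancel₀ _ hks'.ne', div_mul_cancel₀ _ hns.ne']
      ring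
  · rw [← sum_val_lt_add_sum_le_val k]
    have h1 : ∑ i : Fin n with i.val < k, D i j = if j.val < k then 1 else 0 := by
      have : ∀ i ∈ Finset.univ.filter fun i : Fin n => i.val < k,
          D i j = if i = j then 1 else 0 := by
        intro i hi
        simp only [Finset.mem_filter] at hi
        simp [D, hi.2]
      rw [Finset.sum_congr rfl this, Finset.sum_ite_eq']
      simp
    have h2 : ∀ i ∈ Finset.univ.filter fun i : Fin n => k ≤ i.val, D i j =
        if j.val < k then 0 else if j.val < s then l i / b / (s - k)
          else (1 - l i / b) / (n - s) := by
      intro i hi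
      simp only [Finset.mem_filter] at hi
      simp [D, hi.2.not_gt]
    rw [h1, Finset.sum_congr rfl h2]
    split_ifs with h3 h4
    · simp
    · rw [← Finset.sum_div, ← Finset.sum_div, hsum]
      field_simp
      ring
    · rw [← Finset.sum_div, Finset.sum_sub_distrib, ← Finset.sum_div, hsum, Finset.sum_const,
        nsmul_eq_mul, hcard3]
      field_simp
      ring
  · funext i
    rw [Matrix.mulVec, dotProduct]
    by_cases hi : i.val < k
    · rw [Finset.sum_eq_single i (fun j _ hj => by simp [D, hi, hj.symm]) (by simp)]
      simp [D, hi, hμ]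
    · rw [hrow i (by omega)]
      have h1 : ∑ j : Fin n with k ≤ j.val ∧ j.val < s, μ j = (s - k) * b := by
        rw [← hcard1, ← nsmul_eq_mul, ← Finset.sum_const]
        refine Finset.sum_congr rfl fun j hj => ?_
        simp only [Finset.mem_filter] at hj
        simp [hμ, hj.2.1.not_gt, hj.2.2]
      have h2 : ∑ j : Fin n with s ≤ j.val, μ j = 0 := by
        refine Finset.sum_eq_zero fun j hj => ?_
        simp only [Finset.mem_filter] at hj
        simp [hμ, (hks.le.trans hj.2).not_gt, hj.2.not_gt]
      rw [h1, h2]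
      field_simp
      ring

/-! ### The split index and the weights γ. -/

theorem perturb_antitone {s : ℕ} {t : ℝ} (ht : 0 ≤ t) {l : Fin n → ℝ} (hl : Antitone l) :
    Antitone (perturb s t l) := by
  intro i j hij
  have h1 := hl hij
  have h2 := Fin.le_def.mp hij
  unfold perturb
  split_ifs <;> first | omega | linarith

theorem sum_mul_perturb (s : ℕ) (t : ℝ) (a l : Fin n → ℝ) :
    ∑ i, a i * perturb s t l i = ∑ i, a i * l i + t * ∑ i : Fin n with i.val < s, a i := by
  rw [Finset.sum_filter, Finset.mul_sum, ← Finset.sum_add_distrib]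
  refine Finset.sum_congr rfl fun i _ => ?_
  unfold perturb
  split_ifs <;> ring

theorem tailAvg_perturb {k s : ℕ} (hks : k < s) (hsn : s ≤ n) (t : ℝ) (l : Fin n → ℝ) :
    ((s : ℝ) - k) * (tailAvg s k (perturb s t l) - t) = ∑ i : Fin n with k ≤ i.val, l i := by
  have hks' : (0 : ℝ) < (s : ℝ) - k := sub_pos.mpr (by exact_mod_cast hks)
  have h : ∑ i : Fin n with k ≤ i.val, perturb s t l i =
      (∑ i : Fin n with k ≤ i.val, l i) + ((s : ℝ) - k) * t := by
    rw [← Nat.cast_sub hks.le, ← card_le_val_lt (n := n) hks.le hsn, ← nsmul_eq_mul,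
      ← Finset.sum_const, ← Finset.filter_filter, Finset.sum_filter _ (fun _ => t),
      ← Finset.sum_add_distrib]
    refine Finset.sum_congr rfl fun i _ => ?_
    unfold perturb
    split_ifs <;> ring
  rw [tailAvg, h]
  field_simp
  ring

theorem psiGrad_eq (s k : ℕ) (y : Fin n → ℝ) (i : Fin n) :
    psiGrad s k y i = if i.val < k then (y i)⁻¹ else (tailAvg s k y)⁻¹ := by
  simp [psiGrad, tailAvg]

section Split

variable {s k : ℕ} {y : Fin n → ℝ}

theorem IsSplitIndex.tailAvg_lt (h : IsSplitIndex s y k) (hsn : s ≤ n) (hy : Antitone y)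
    {i : Fin n} (hi : i.val < k) : tailAvg s k y < y i := by
  have hk := h.1
  exact (h.2.1 ⟨k - 1, by omega⟩ (by simp; omega)).trans_le (hy (Fin.le_def.mpr (by simp; omega)))

theorem IsSplitIndex.le_tailAvg (h : IsSplitIndex s y k) (hy : Antitone y) {i : Fin n}
    (hi : k ≤ i.val) : y i ≤ tailAvg s k y :=
  (hy (Fin.le_def.mpr hi)).trans (h.2.2 ⟨k, by omega⟩ rfl)

theorem psiGrad_pos (h : IsSplitIndex s y k) (hsn : s ≤ n) (hy : Antitone y)
    (hc : 0 < tailAvg s k y) (i : Fin n) : 0 < psiGrad s k y i := by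
  rw [psiGrad_eq]
  split_ifs with hi
  · exact inv_pos.mpr (hc.trans (h.tailAvg_lt hsn hy hi))
  · exact inv_pos.mpr hc

theorem psiGrad_monotone (h : IsSplitIndex s y k) (hsn : s ≤ n) (hy : Antitone y)
    (hc : 0 < tailAvg s k y) : Monotone (psiGrad s k y) := by
  intro i j hij
  have hij' := Fin.le_def.mp hij
  rw [psiGrad_eq, psiGrad_eq]
  split_ifs with hi hj hj
  · exact inv_anti₀ (hc.trans (h.tailAvg_lt hsn hy hj)) (hy hij)
  · exact inv_anti₀ hc (h.tailAvg_lt hsn hy hi).le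
  · omega
  · exact le_rfl

/-- The first k terms are 1 each and the tail contributes s - k. -/
theorem sum_psiGrad_mul (h : IsSplitIndex s y k) (hsn : s ≤ n) (hy : Antitone y)
    (hc : 0 < tailAvg s k y) : ∑ i, psiGrad s k y i * y i = s := by
  have hks' : (0 : ℝ) < (s : ℝ) - k := sub_pos.mpr (by exact_mod_cast h.1)
  rw [← sum_val_lt_add_sum_le_val k]
  have h1 : ∑ i : Fin n with i.val < k, psiGrad s k y i * y i = k := by
    rw [Finset.sum_congr rfl (g := fun _ => (1 : ℝ)), Finset.sum_const,
      card_val_lt (h.1.le.trans hsn), nsmul_eq_mul, mul_one]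
    intro i hi
    have hi' : i.val < k := (Finset.mem_filter.mp hi).2
    rw [psiGrad_eq, if_pos hi', inv_mul_cancel₀ (hc.trans (h.tailAvg_lt hsn hy hi')).ne']
  have h2 : ∑ i : Fin n with k ≤ i.val, psiGrad s k y i * y i =
      (tailAvg s k y)⁻¹ * ∑ i : Fin n with k ≤ i.val, y i := by
    rw [Finset.mul_sum]
    refine Finset.sum_congr rfl fun i hi => ?_
    rw [psiGrad_eq, if_neg (Finset.mem_filter.mp hi).2.not_gt]
  have h3 : ∑ i : Fin n with k ≤ i.val, y i = tailAvg s k y * (s - k) := by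
    rw [tailAvg, div_mul_cancel₀ _ hks'.ne']
  rw [h1, h2, h3, inv_mul_cancel_left₀ hc.ne']
  ring

end Split

/-! ### Affine majorant, envelope and linearization. -/

theorem sum_log_le_Phi_conj_diagonal {s : ℕ} {t : ℝ} (ht : 0 < t)
    {Q : Matrix (Fin n) (Fin n) ℝ} (hQ : Q ∈ Matrix.orthogonalGroup (Fin n) ℝ) {d : Fin n → ℝ}
    (hd : ∀ i, 0 ≤ d i) {T : Finset (Fin n)} (hT : T.card = s) :
    ∑ i ∈ T, Real.log (d i + t) ≤ Phi s t (Q * Matrix.diagonal d * Qᵀ) := by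
  obtain ⟨σ, hσ⟩ := exists_perm_desc_eq d
  have hanti : Antitone fun i => Real.log (desc d i + t) := fun i j hij =>
    Real.log_le_log (by rw [hσ]; have := hd (σ j); simp; linarith)
      (by have := desc_antitone d hij; linarith)
  have h := sum_le_sum_val_lt hanti (T.map σ.symm.toEmbedding)
  rw [Phi, eig_conj_diagonal hQ]
  rw [Finset.card_map, hT, Finset.sum_map] at h
  simpa [hσ] using h

/-- Affine overestimation of `Φ_s` by any spectral functional with monotone positive weights. -/
theorem Phi_le_affine {s : ℕ} (hsn : s ≤ n) {t : ℝ} (ht : 0 < t) {Q : Matrix (Fin n) (Fin n) ℝ}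
    (hQ : Q ∈ Matrix.orthogonalGroup (Fin n) ℝ) {a : Fin n → ℝ} (ha : Monotone a)
    (ha0 : ∀ i, 0 < a i) {X : Matrix (Fin n) (Fin n) ℝ} (hX : X.PosSemidef) :
    Phi s t X ≤ (∑ i : Fin n with i.val < s, -Real.log (a i)) +
      ((Q * Matrix.diagonal a * Qᵀ) * X).trace +
      t * (∑ i : Fin n with i.val < s, a i) - s := by
  have h1 := sum_mul_eig_le_trace hQ ha hX.isHermitian
  have h2 : ∑ i : Fin n with i.val < s, a i * eig X i ≤ ∑ i, a i * eig X i :=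
    Finset.sum_le_sum_of_subset_of_nonneg (Finset.subset_univ _) fun i _ _ =>
      mul_nonneg (ha0 i).le (eig_nonneg hX i)
  have h3 : Phi s t X ≤ ∑ i : Fin n with i.val < s,
      (-Real.log (a i) + a i * eig X i + t * a i - 1) := by
    refine Finset.sum_le_sum fun i _ => ?_
    have hpos : 0 < eig X i + t := add_pos_of_nonneg_of_pos (eig_nonneg hX i) ht
    -- Tangent to log at 1, evaluated at a_i (λ_i + t).
    have h4 := Real.log_le_sub_one_of_pos (mul_pos (ha0 i) hpos)
    rw [Real.log_mul (ha0 i).ne' hpos.ne'] at h4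
    linarith
  rw [Finset.sum_sub_distrib, Finset.sum_add_distrib, Finset.sum_add_distrib, ← Finset.mul_sum,
    Finset.sum_const, card_val_lt hsn, nsmul_eq_mul, mul_one] at h3
  linarith

/-- Makes the set inside the `sInf` of `concaveEnvelope` nonempty, as `le_csInf` requires. The
witness is the affine majorant with all weights 1. -/
theorem exists_concave_overestimator {s : ℕ} (hsn : s ≤ n) {t : ℝ} (ht : 0 < t) :
    ∃ h : Matrix (Fin n) (Fin n) ℝ → ℝ,
      ConcaveOn ℝ {Y : Matrix (Fin n) (Fin n) ℝ | Y.PosSemidef} h ∧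
        ∀ Y ∈ {Y : Matrix (Fin n) (Fin n) ℝ | Y.PosSemidef}, Phi s t Y ≤ h Y := by
  refine ⟨fun Y => Y.trace + (t * s - s), ⟨?_, ?_⟩, fun Y hY => ?_⟩
  · intro X hX Y hY a b ha hb _
    exact (hX.smul ha).add (hY.smul hb)
  · intro X _ Y _ a b _ _ hab
    simp only [smul_eq_mul, Matrix.trace_add, Matrix.trace_smul]
    apply le_of_eq
    linear_combination (t * s - s) * hab
  · have := Phi_le_affine (s := s) hsn ht (one_mem (Matrix.orthogonalGroup (Fin n) ℝ))
      (monotone_const (c := (1 : ℝ))) (fun _ => one_pos) hY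
    have h1 : (Matrix.diagonal fun _ : Fin n => (1 : ℝ)) = 1 := Matrix.diagonal_one
    simp only [h1, Matrix.one_mul, Matrix.transpose_one, Real.log_one, neg_zero,
      Finset.sum_const_zero, Finset.sum_const, card_val_lt hsn, nsmul_eq_mul, mul_one] at this
    linarith

theorem sum_neg_log_psiGrad_le_PhiHat {s k : ℕ} (hsn : s ≤ n) {t : ℝ} (ht : 0 < t)
    {Q : Matrix (Fin n) (Fin n) ℝ} (hQ : Q ∈ Matrix.orthogonalGroup (Fin n) ℝ) {l : Fin n → ℝ}
    (hl : Antitone l) (hl0 : ∀ i, 0 ≤ l i) (hk : IsSplitIndex s (perturb s t l) k) :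
    ∑ i : Fin n with i.val < s, -Real.log (psiGrad s k (perturb s t l) i) ≤
      PhiHat s t (Q * Matrix.diagonal l * Qᵀ) := by
  set c := tailAvg s k (perturb s t l) with hc
  have hy := perturb_antitone (s := s) ht.le hl
  have hsum := tailAvg_perturb hk.1 hsn t l
  rw [← hc] at hsum
  have hbl : ∀ i : Fin n, k ≤ i.val → l i ≤ c - t := by
    intro i hi
    have h1 := hk.le_tailAvg hy (i := ⟨k, hi.trans_lt i.isLt⟩) le_rfl
    have h2 : l i ≤ l ⟨k, hi.trans_lt i.isLt⟩ := hl (Fin.le_def.mpr hi)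
    simp only [perturb, hk.1, if_true] at h1
    have h3 : l ⟨k, hi.trans_lt i.isLt⟩ + t ≤ c := h1
    linarith
  have hkn : k < n := hk.1.trans_le hsn
  have hb0 : 0 ≤ c - t := (hl0 ⟨k, hkn⟩).trans (hbl ⟨k, hkn⟩ le_rfl)
  -- Chosen so that μ_i + t = 1 / γ_i for the first s positions.
  set μ : Fin n → ℝ := fun i => if i.val < k then l i else if i.val < s then c - t else 0 with hμ
  have hμ0 : ∀ i, 0 ≤ μ i := by
    intro i
    simp only [hμ]
    split_ifs
    exacts [hl0 i, hb0, le_rfl]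
  obtain ⟨D, hD, hDl⟩ := exists_doublyStochastic_mulVec_eq hk.1 hsn hl0 hbl hsum.symm
  have hval : ∑ i : Fin n with i.val < s, -Real.log (psiGrad s k (perturb s t l) i) =
      ∑ i : Fin n with i.val < s, Real.log (μ i + t) := by
    refine Finset.sum_congr rfl fun i hi => ?_
    have hi' : i.val < s := (Finset.mem_filter.mp hi).2
    rw [psiGrad_eq, ← hc]
    by_cases h : i.val < k
    · simp [hμ, h, perturb, hi']
    · simp [hμ, h, hi']
  rw [hval]
  set L := ∑ i : Fin n with i.val < s, Real.log (μ i + t) with hL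
  have hmem : l ∈ convexHull ℝ (Set.range fun σ : Equiv.Perm (Fin n) => μ ∘ σ) :=
    hDl ▸ mulVec_mem_convexHull hD μ
  obtain ⟨h₀, hh₀⟩ := exists_concave_overestimator (n := n) hsn ht
  refine le_csInf ⟨_, h₀, hh₀.1, hh₀.2, rfl⟩ ?_
  rintro _ ⟨h, hconc, hover, rfl⟩
  have hlin : IsLinearMap ℝ fun v : Fin n → ℝ => Q * Matrix.diagonal v * Qᵀ :=
    ⟨fun v w => by
      rw [← Matrix.add_mul, ← Matrix.mul_add, Matrix.diagonal_add]; rfl,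
      fun r v => by rw [Matrix.diagonal_smul, Matrix.mul_smul, Matrix.smul_mul]⟩
  -- Superlevel sets of h are convex, so h ≥ L at the permutations of μ carries over to their convex
  -- hull, which contains l.
  have hconv := (hconc.convex_ge L).is_linear_preimage hlin
  have hsub : (Set.range fun σ : Equiv.Perm (Fin n) => μ ∘ σ) ⊆
      (fun v : Fin n → ℝ => Q * Matrix.diagonal v * Qᵀ) ⁻¹'
        {X | X ∈ {Y : Matrix (Fin n) (Fin n) ℝ | Y.PosSemidef} ∧ L ≤ h X} := by
    rintro _ ⟨σ, rfl⟩
    have hpsd := posSemidef_conj_diagonal Q (d := μ ∘ σ) fun i => hμ0 (σ i)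
    refine ⟨hpsd, le_trans ?_ (hover _ hpsd)⟩
    have := sum_log_le_Phi_conj_diagonal ht hQ (d := μ ∘ σ) (fun i => hμ0 (σ i))
      (T := (Finset.univ.filter fun i : Fin n => i.val < s).map σ.symm.toEmbedding)
      ((Finset.card_map _).trans (card_val_lt hsn))
    simpa [hL] using this
  exact (convexHull_min hsub hconv hmem).2

/-- The upper bound on `log det C_{S,S}` given by the linearisation at `x`. -/
theorem logDet_le_linearization {s : ℕ} (hsn : s ≤ n) {C : Matrix (Fin n) (Fin n) ℝ} {t : ℝ}
    (ht : 0 < t) {A : Matrix (Fin n) (Fin n) ℝ} (hA : IsFactor C t A) {x g : Fin n → ℝ}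
    (hx : IsFeasible s x) (hg : IsSpectralSubgradient A s t x g) {S : Finset (Fin n)}
    (hS : S.card = s) :
    logDet C S ≤ PhiHat s t (M A x) - g ⬝ᵥ x + ∑ i ∈ S, g i := by
  obtain ⟨Q, l, k, hQ, hl, hM, hk, hg⟩ := hg
  have hl0 : ∀ i, 0 ≤ l i :=
    nonneg_of_conj_diagonal_posSemidef hQ (hM ▸ M_posSemidef A fun i => (hx.1 i).1)
  have hy := perturb_antitone (s := s) ht.le hl
  have hc : 0 < tailAvg s k (perturb s t l) := by
    have hks' : (0 : ℝ) < (s : ℝ) - k := sub_pos.mpr (by exact_mod_cast hk.1)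
    have h1 := tailAvg_perturb hk.1 hsn t l
    have h2 : 0 ≤ ((s : ℝ) - k) * (tailAvg s k (perturb s t l) - t) :=
      h1 ▸ Finset.sum_nonneg fun i _ => hl0 i
    have := nonneg_of_mul_nonneg_right h2 hks'
    linarith
  set γ := psiGrad s k (perturb s t l) with hγ
  have hbound := sum_neg_log_psiGrad_le_PhiHat hsn ht hQ hl hl0 hk
  rw [← hM] at hbound
  -- This sum is also g·x, so the constant t ∑ γ_i - s of the affine majorant is exactly -g·x.
  have hγl : ∑ i, γ i * l i = s - t * ∑ i : Fin n with i.val < s, γ i := by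
    have h1 := sum_mul_perturb s t γ l
    rw [sum_psiGrad_mul hk hsn hy hc] at h1
    linarith
  have htr : ∀ z : Fin n → ℝ,
      ((Q * Matrix.diagonal γ * Qᵀ) * M A z).trace = ∑ i, z i * g i := fun z => by
    rw [trace_mul_M]
    exact Finset.sum_congr rfl fun i _ => by rw [hg i]
  have htrx : g ⬝ᵥ x = ∑ i, γ i * l i := by
    rw [dotProduct_comm, dotProduct, ← htr x, hM]
    have hQQ := transpose_mul_self_of_mem hQ
    have h1 : (Q * Matrix.diagonal γ * Qᵀ) * (Q * Matrix.diagonal l * Qᵀ) =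
        Q * (Matrix.diagonal γ * Matrix.diagonal l) * Qᵀ := by
      calc _ = Q * Matrix.diagonal γ * (Qᵀ * Q) * Matrix.diagonal l * Qᵀ := by
            simp only [Matrix.mul_assoc]
        _ = _ := by rw [hQQ]; simp only [Matrix.mul_assoc, Matrix.one_mul]
    rw [h1, Matrix.trace_mul_comm, ← Matrix.mul_assoc, hQQ, Matrix.one_mul,
      Matrix.diagonal_mul_diagonal, Matrix.trace_diagonal]
  have hPhi := Phi_le_affine hsn ht hQ (psiGrad_monotone hk hsn hy hc)
    (psiGrad_pos hk hsn hy hc)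
    (M_posSemidef A (x := fun i => if i ∈ S then 1 else 0)
      fun i => by split_ifs <;> norm_num)
  rw [← hγ, htr] at hPhi
  have hSsum : ∑ i, (if i ∈ S then (1 : ℝ) else 0) * g i = ∑ i ∈ S, g i := by
    simp
  rw [logDet_eq_Phi ht hA, hS, htrx, hγl]
  linarith

/-! ### From the bound to variable fixing. -/

theorem optValue_eq {C : Matrix (Fin n) (Fin n) ℝ} {s : ℕ} {S : Finset (Fin n)}
    (hS : S.card = s) (hmax : ∀ T : Finset (Fin n), T.card = s → logDet C T ≤ logDet C S) :
    optValue C s = logDet C S := by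
  have : Nonempty {S : Finset (Fin n) // S.card = s} := ⟨⟨S, hS⟩⟩
  refine le_antisymm (ciSup_le fun T => hmax T.1 T.2) ?_
  exact le_ciSup (f := fun T : {S : Finset (Fin n) // S.card = s} => logDet C T.1)
    (Set.finite_range _).bddAbove ⟨S, hS⟩

theorem sum_desc_val_lt_succ (g : Fin n → ℝ) {m : ℕ} (hm : m < n) :
    ∑ i : Fin n with i.val < m + 1, desc g i =
      (∑ i : Fin n with i.val < m, desc g i) + desc g ⟨m, hm⟩ := by
  rw [sum_val_lt_eq_add (Nat.le_succ m)]
  congr 1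
  have : (Finset.univ.filter fun i : Fin n => m ≤ i.val ∧ i.val < m + 1) = {⟨m, hm⟩} := by
    ext i
    simp only [Finset.mem_filter, Finset.mem_univ, true_and, Finset.mem_singleton, Fin.ext_iff]
    omega
  rw [this, Finset.sum_singleton]

theorem lambdaMin_pos [Nonempty (Fin n)] {C : Matrix (Fin n) (Fin n) ℝ} (hC : C.PosDef) :
    0 < lambdaMin hC.isHermitian := by
  obtain ⟨i, hi⟩ := exists_eq_ciInf_of_finite (f := hC.isHermitian.eigenvalues)
  rw [lambdaMin, ← hi]
  exact hC.eigenvalues_pos i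

end MESP

theorem theorem6 (n s : ℕ) (hs1 : 1 ≤ s) (hsn : s ≤ n)
    (C : Matrix (Fin n) (Fin n) ℝ) (hC : C.PosDef)
    (t : ℝ) (ht : t = MESP.lambdaMin hC.isHermitian)
    (A : Matrix (Fin n) (Fin n) ℝ) (hA : MESP.IsFactor C t A)
    (x g : Fin n → ℝ) (hx : MESP.IsFeasible s x)
    (hg : MESP.IsSpectralSubgradient A s t x g)
    (LB : ℝ) (hLB : LB ≤ MESP.optValue C s)
    (xopt : Fin n → ℝ) (hopt : MESP.IsOptimal C s xopt) :
    (∀ (h : s < n) (i : Fin n),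
      g i - MESP.desc g ⟨s, h⟩ > MESP.upperBound A s t x g - LB → xopt i = 1) ∧
    (∀ i : Fin n,
      MESP.desc g ⟨s - 1, by omega⟩ - g i > MESP.upperBound A s t x g - LB → xopt i = 0) := by
  have : Nonempty (Fin n) := ⟨⟨0, by omega⟩⟩
  have htpos : 0 < t := ht ▸ MESP.lambdaMin_pos hC
  obtain ⟨S, hS, hmax, hxopt⟩ := hopt
  have hbound := MESP.logDet_le_linearization hsn htpos hA hx hg hS
  rw [MESP.optValue_eq hS hmax] at hLB
  simp only [MESP.upperBound]
  refine ⟨fun h i hi => ?_, fun i hi => ?_⟩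
  · by_contra hne
    have hiS : i ∉ S := fun hmem => hne (by simp [hxopt, hmem])
    have h1 := MESP.sum_le_sum_desc g (insert i S)
    rw [Finset.card_insert_of_notMem hiS, Finset.sum_insert hiS, hS,
      MESP.sum_desc_val_lt_succ g h] at h1
    linarith
  · by_contra hne
    have hiS : i ∈ S := by
      by_contra hmem
      exact hne (by simp [hxopt, hmem])
    -- Removing i leaves s - 1 indices; the top-s sum in UB exceeds the top-(s - 1) sum by g↓_s, at
    -- position s - 1.
    have h1 := MESP.sum_le_sum_desc g (S.erase i)
    have h2 := Finset.add_sum_erase S g hiS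
    have h3 := MESP.sum_desc_val_lt_succ g (m := s - 1) (by omega)
    rw [Nat.sub_add_cancel hs1] at h3
    rw [Finset.card_erase_of_mem hiS, hS] at h1
    linarith
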